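/- **The RSKR repetition code attains the secrecy bound for node-restricted eavesdroppers.** Setting. Let $L\ge 1$, $n_I\ge 1$, $0\le L_c\le L$, $\beta\in\mathbb N$, and let $n=Ln_I$ storage nodes be divided into $L$ clusters of $n_I$ nodes. Symbols are elements of a finite field $\mathbb F_q$, and all amounts of data are counted in symbols. Each node stores at most $\alpha$ symbols, and any $k=n-1$ nodes must reconstruct the file. When a node fails, a newcomer in the same cluster downloads $\beta$ symbols from each of the $d=n-1$ other nodes. A node-restricted eavesdropper with $L_c$ compromised clusters reads, during the repairs, every transmission between two different clusters that enters or leaves a compromised cluster, and nothing else. Assume the bandwidth-limited regime $\alpha\ge d\beta$. RSKR repetition code. It consists of $\beta$ parallel layers. In each layer there is one coded symbol for every unordered pair of distinct nodes, stored on both nodes of the pair; in a repair each helper transmits the $\beta$ symbols that it shares with the newcomer, and the newcomer stores what it receives. Let $S$ and $T$ be the sets of pairs inside one cluster and across two clusters, and let $\mu=\sum_{i=1}^{L_c}n_I(n-in_I)$. The symbols of $S$ are uncoded message symbols. In each layer the symbols of $T$ are a codeword of a wiretap-channel-II code with parameters $(N,\mu)$, $N=|T|$, with keys independent across the layers: a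 randomized encoder (with a uniform key) of $N-\mu$ message symbols into $N$ symbols such that all $N$ symbols determine the message and any $\mu$ of them have a distribution that does not depend on the message. Claim. Suppose $q\ge |T|$. Then: 1. each coded symbol is stored on exactly two nodes, and in each layer any two distinct nodes share exactly one coded symbol; 2. wiretap-channel-II codes with parameters $(|T|,\mu)$ over $\mathbb F_q$ exist; 3. with any such code, the RSKR code stores intra-cluster symbols uncoded and cross-cluster symbols encoded by the wiretap code; each node stores at most $\alpha$ symbols; after every finite sequence of failures and repairs any $n-1$ nodes reconstruct the message; and for every choice of $L_c$ compromised clusters and every such sequence, the distribution of all that the eavesdropper reads does not depend on the message; 4. the message, hence the secure amount, consists of exactly $$\Bigl(L_c\binom{n_I}{2}+\binom{n-n_IL_c}{2}\Bigr)\beta$$ symbols, and this number equals $C_s^U(\alpha,\gamma)$ with $\gamma=d\beta$ and $k=n-1$, where $$C_s^U(\alpha,\gamma)=\begin{cases}L_c\sum_{i=1}^{n_I}\min\{(n_I-i)\beta,\alpha\}+\sum_{i=n_IL_c+1}^{k}\min\{(n-i)\beta,\alpha\}, & n_IL_c<k,\\[4pt] \lfloor k/n_I\rfloor\sum_{i=1}^{n_I}\min\{(n_I-i)\beta,\alpha\}+\sum_{i=1}^{k\bmod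 n_I}\min\{(n_I-i)\beta,\alpha\}, & \text{otherwise.}\end{cases}$$ -/

import Mathlib

universe u v w

/-! ### Perfect secrecy and the wiretap channel II -/

/-- Shannon's perfect secrecy: when the key is uniform, the law of the observation is the same for
every message. -/
def PerfectlySecret {Msg : Type u} {Key : Type v} {Obs : Type w} [Fintype Key] [Nonempty Key]
    (obs : Msg → Key → Obs) : Prop :=
  ∀ m m' : Msg, (PMF.uniformOfFintype Key).map (obs m) = (PMF.uniformOfFintype Key).map (obs m')

/-- A code for the wiretap channel II with parameters `(N, μ)`, `N = |ι|`: `N - μ` message symbols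
are encoded with the help of a uniform key into `N` symbols; all `N` symbols determine the message,
and any `μ` of them reveal nothing about it. -/
structure WiretapIICode (F : Type u) (ι : Type v) (μ : ℕ) where
  Key : Type u
  [keyFintype : Fintype Key]
  [keyNonempty : Nonempty Key]
  enc : (Fin (Nat.card ι - μ) → F) → Key → ι → F
  dec : (ι → F) → Fin (Nat.card ι - μ) → F
  dec_enc : ∀ m r, dec (enc m r) = m
  secret : ∀ A : Finset ι, A.card ≤ μ → PerfectlySecret (fun m r (i : A) => enc m r i)

attribute [instance] WiretapIICode.keyFintype WiretapIICode.keyNonempty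

/-! ### Clustered distributed storage with repair -/

/-- A storage scheme on the nodes `V` over the symbol alphabet `F`. Node `x` stores one symbol for
each element of `Slot x`. When a node fails, its newcomer downloads `β` symbols from each of the
other nodes and computes its new content from them. No property is assumed here. -/
structure StorageScheme (F : Type u) (V : Type) (Slot : V → Type) (β : ℕ)
    (Msg Key : Type u) where
  encode : Msg → Key → (x : V) → Slot x → F
  /-- what the helper `x` transmits to the newcomer `y`, as a function of the content of `x` -/
  send : (x y : V) → x ≠ y → (Slot x → F) → Fin β → F
  rebuild : (y : V) → ({x : V // x ≠ y} → Fin β → F) → Slot y → F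

namespace StorageScheme

variable {F : Type u} {V : Type} {Slot : V → Type} {β : ℕ} {Msg Key : Type u}

open Classical in
/-- The state of the system after node `y` has failed and has been repaired. -/
noncomputable def step (S : StorageScheme F V Slot β Msg Key) (c : (x : V) → Slot x → F) (y : V) :
    (x : V) → Slot x → F :=
  Function.update c y (S.rebuild y fun x => S.send x.1 y x.2 (c x.1))

/-- The state after a sequence of failures and repairs. -/
noncomputable def run (S : StorageScheme F V Slot β Msg Key) (c : (x : V) → Slot x → F)
    (h : List V) : (x : V) → Slot x → F :=
  h.foldl S.step c

open Classical in
/-- What the node-restricted eavesdropper with compromised clusters `E` reads during a sequence of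
failures and repairs that starts in state `c`: in every repair, all transmissions between different
clusters that enter or leave a compromised cluster. -/
noncomputable def view (S : StorageScheme F V Slot β Msg Key) {C : Type} (cluster : V → C)
    (E : Finset C) : ((x : V) → Slot x → F) → List V → List (V → Option (Fin β → F))
  | _, [] => []
  | c, y :: h =>
      (fun x =>
        if hx : cluster x ≠ cluster y ∧ (cluster x ∈ E ∨ cluster y ∈ E) then
          some (S.send x y (fun e => hx.1 (congrArg cluster e)) (c x))
        else none) :: S.view cluster E (S.step c y) h

/-- The scheme stores `M` symbols securely in a clustered system with node size `α`, in which any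
`k` nodes reconstruct the file and any `Lc` clusters may be compromised by a node-restricted
eavesdropper, whatever failures and repairs occur. -/
structure SecurelyStores (S : StorageScheme F V Slot β Msg Key) [Fintype Key] [Nonempty Key]
    {C : Type} (cluster : V → C) (k Lc : ℕ) (α : ℝ) (M : ℕ) : Prop where
  finite_slot : ∀ x, Finite (Slot x)
  storage : ∀ x, (Nat.card (Slot x) : ℝ) ≤ α
  amount : Nat.card Msg = Nat.card F ^ M
  reconstruct : ∀ (h : List V) (K : Finset V), K.card = k →
    ∃ dec : ((x : K) → Slot x.1 → F) → Msg,
      ∀ m r, dec (fun x => S.run (S.encode m r) h x.1) = m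
  secret : ∀ (h : List V) (E : Finset C), E.card = Lc →
    PerfectlySecret (fun m r => S.view cluster E (S.encode m r) h)

end StorageScheme

/-- The upper bound on the secrecy capacity under the node-restricted eavesdropper, for `n` nodes
in clusters of size `nI`, any `k` nodes reconstructing, and `Lc` compromised clusters. -/
noncomputable def nodeRestrictedBound (n k nI Lc : ℕ) (α β : ℝ) : ℝ :=
  if nI * Lc < k then
    (Lc : ℝ) * ∑ i ∈ Finset.Icc 1 nI, min (((nI : ℝ) - i) * β) α
      + ∑ i ∈ Finset.Icc (nI * Lc + 1) k, min (((n : ℝ) - i) * β) α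
  else
    ((k / nI : ℕ) : ℝ) * ∑ i ∈ Finset.Icc 1 nI, min (((nI : ℝ) - i) * β) α
      + ∑ i ∈ Finset.Icc 1 (k % nI), min (((nI : ℝ) - i) * β) α

/-! ### The RSKR repetition code -/

namespace RSKR

/-- The nodes: `L` clusters (first coordinate) of `nI` nodes each. -/
abbrev Node (L nI : ℕ) : Type := Fin L × Fin nI

/-- Unordered pairs of distinct nodes. -/
abbrev Pair (L nI : ℕ) : Type := {e : Sym2 (Node L nI) // ¬ e.IsDiag}

/-- Both nodes of the pair lie in the same cluster. -/
def Intra {L nI : ℕ} (e : Pair L nI) : Prop := ∀ x ∈ e.1, ∀ y ∈ e.1, x.1 = y.1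

abbrev IntraPair (L nI : ℕ) : Type := {e : Pair L nI // Intra e}

abbrev CrossPair (L nI : ℕ) : Type := {e : Pair L nI // ¬ Intra e}

/-- The coded symbols: `β` parallel copies (layers) of one symbol per pair of nodes. -/
abbrev Sym (L nI β : ℕ) : Type := Pair L nI × Fin β

/-- The coded symbols that are stored on a node. -/
def storedOn {L nI β : ℕ} (x : Node L nI) : Set (Sym L nI β) := {s | x ∈ s.1.1}

abbrev Slot (L nI β : ℕ) (x : Node L nI) : Type := {s : Sym L nI β // s ∈ storedOn x}

/-- The number of cross-cluster symbols that `Lc` compromised clusters expose in each layer. -/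
def exposed (L nI Lc : ℕ) : ℕ := ∑ i ∈ Finset.Icc 1 Lc, nI * (L * nI - i * nI)

/-- The wiretap channel II codes that protect the cross-cluster symbols of a layer. -/
abbrev CrossCode (F : Type u) (L nI Lc : ℕ) : Type (u + 1) :=
  WiretapIICode F (CrossPair L nI) (exposed L nI Lc)

/-- The secret message: one symbol for each intra-cluster coded symbol, and one message of the
wiretap code for each layer. -/
abbrev Msg (F : Type u) (L nI Lc β : ℕ) : Type u :=
  (IntraPair L nI → Fin β → F) ×
    (Fin β → Fin (Nat.card (CrossPair L nI) - exposed L nI Lc) → F)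

open Classical in
/-- The coded symbols: uncoded message symbols inside the clusters, and in each layer a wiretap
codeword (with a fresh key) across the clusters. -/
noncomputable def codeword {F : Type u} {L nI Lc β : ℕ} (W : CrossCode F L nI Lc)
    (m : Msg F L nI Lc β) (r : Fin β → W.Key) (s : Sym L nI β) : F :=
  if h : Intra s.1 then m.1 ⟨s.1, h⟩ s.2 else W.enc (m.2 s.2) (r s.2) ⟨s.1, h⟩

/-- The RSKR repetition code with repair by transfer: each helper hands over the `β` symbols that
it shares with the newcomer, and the newcomer stores what it receives. -/
noncomputable def scheme {F : Type u} {L nI Lc : ℕ} (β : ℕ) (W : CrossCode F L nI Lc) :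
    StorageScheme F (Node L nI) (Slot L nI β) β (Msg F L nI Lc β) (Fin β → W.Key) where
  encode m r _ s := codeword W m r s.1
  send x y hxy c b := c ⟨(⟨s(x, y), by simpa using hxy⟩, b), Sym2.mem_mk_left x y⟩
  rebuild _ f s := f ⟨Sym2.Mem.other s.2, Sym2.other_ne s.1.1.2 s.2⟩ s.1.2

end RSKR

/-! ### Perfect secrecy -/

/-! Repair by transfer is exact: the newcomer gets back precisely the symbols it lost, so an encoded
state is fixed by every repair (`step_encode`) and each claim about a history reduces to the initial
codeword. Any `n - 1` nodes miss a single node while each symbol has two copies, so they hold the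
whole codeword. For secrecy, everything read is a function of the cross-cluster symbols on pairs
touching a compromised cluster. By `card_touching` there are exactly `μ` of these per layer, which
the wiretap code tolerates; independent keys extend this to all layers (`PerfectlySecret.pi`).
Wiretap codes come from polynomial evaluation. The amounts agree because no minimum in the bound is
attained only by `α`, which leaves sums of consecutive integers. -/

theorem PMF.map_uniformOfFintype_apply {K : Type u} {O : Type v} [Fintype K] [Nonempty K]
    (f : K → O) (o : O) :
    (PMF.uniformOfFintype K).map f o = Nat.card {r // f r = o} * (Fintype.card K : ENNReal)⁻¹ := by
  classical
  rw [PMF.map_apply, tsum_fintype]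
  simp only [PMF.uniformOfFintype_apply]
  rw [← Finset.sum_filter, Finset.sum_const, nsmul_eq_mul, Nat.card_eq_fintype_card,
    Fintype.card_subtype]
  simp only [eq_comm]

theorem perfectlySecret_iff {M : Type u} {K : Type v} {O : Type w} [Fintype K] [Nonempty K]
    {obs : M → K → O} :
    PerfectlySecret obs ↔
      ∀ m m' o, Nat.card {r // obs m r = o} = Nat.card {r // obs m' r = o} := by
  refine forall₂_congr fun m m' => ?_
  rw [PMF.ext_iff]
  refine forall_congr' fun o => ?_
  rw [PMF.map_uniformOfFintype_apply, PMF.map_uniformOfFintype_apply,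
    ENNReal.mul_left_inj (by simp) (by simp), Nat.cast_inj]

theorem PerfectlySecret.of_perm {M : Type u} {K : Type v} {O : Type w} [Fintype K] [Nonempty K]
    {obs : M → K → O} (h : ∀ m m', ∃ σ : Equiv.Perm K, ∀ r, obs m r = obs m' (σ r)) :
    PerfectlySecret obs := by
  refine perfectlySecret_iff.2 fun m m' o => ?_
  obtain ⟨σ, hσ⟩ := h m m'
  exact Nat.card_congr (σ.subtypeEquiv fun r => by rw [hσ])

theorem PerfectlySecret.postcomp {M : Type u} {K : Type v} {O : Type w} {O' : Type*} [Fintype K]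
    [Nonempty K] {obs : M → K → O} (h : PerfectlySecret obs) (g : O → O') :
    PerfectlySecret fun m r => g (obs m r) := fun m m' => by
  have := congrArg (PMF.map g) (h m m')
  rwa [PMF.map_comp, PMF.map_comp] at this

/-- The fibre over a tuple of observations is the product of the fibres, so key counts multiply. -/
theorem PerfectlySecret.pi {J : Type*} [Fintype J] [DecidableEq J] {M : Type u} {K : Type v}
    {O : Type w} [Fintype K] [Nonempty K] {obs : M → K → O} (h : PerfectlySecret obs) :
    PerfectlySecret fun (m : J → M) (r : J → K) j => obs (m j) (r j) := by
  refine perfectlySecret_iff.2 fun m m' o => ?_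
  have key : ∀ m : J → M, Nat.card {r : J → K // (fun j => obs (m j) (r j)) = o} =
      ∏ j, Nat.card {r // obs (m j) r = o j} := fun m => by
    rw [← Nat.card_pi]
    exact Nat.card_congr ((Equiv.subtypeEquivRight fun r => funext_iff).trans
      (Equiv.subtypePiEquivPi (p := fun j r => obs (m j) r = o j)))
  rw [key, key]
  exact Finset.prod_congr rfl fun j _ => perfectlySecret_iff.1 h _ _ _

/-! ### Wiretap codes from polynomial evaluation -/

section Wiretap

open Polynomial

theorem exists_dec {M : Type u} {K : Type v} {O : Type w} [Nonempty M] (f : M → K → O)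
    (hf : ∀ m r m' r', f m r = f m' r' → m = m') : ∃ dec : O → M, ∀ m r, dec (f m r) = m := by
  classical
  refine ⟨fun o => if h : ∃ m r, f m r = o then h.choose else Classical.arbitrary M,
    fun m r => ?_⟩
  have h : ∃ m' r', f m' r' = f m r := ⟨m, r, rfl⟩
  obtain ⟨r', hr'⟩ := h.choose_spec
  simpa only [dif_pos h] using hf _ _ _ _ hr'

/-- The key supplies the coefficients below `X ^ μ`, the message those above. All `N` values
determine a polynomial of degree below `N`; on at most `μ` points, a change of message is offset by
a translation of the key. -/
theorem exists_wiretapIICode {F : Type u} [Field F] [Fintype F] {ι : Type v} [Finite ι] (μ : ℕ)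
    (hF : Nat.card ι ≤ Nat.card F) : Nonempty (WiretapIICode F ι μ) := by
  classical
  cases nonempty_fintype ι
  obtain ⟨x⟩ : Nonempty (ι ↪ F) := by
    rw [Nat.card_eq_fintype_card, Nat.card_eq_fintype_card] at hF
    exact Function.Embedding.nonempty_of_card_le hF
  let p (n : ℕ) (c : Fin n → F) : F[X] := ((degreeLTEquiv F n).symm c : degreeLT F n)
  have p_deg (n : ℕ) (c : Fin n → F) : (p n c).degree < n :=
    mem_degreeLT.1 ((degreeLTEquiv F n).symm c).2
  have p_coeff (n : ℕ) (c : Fin n → F) (j : Fin n) : (p n c).coeff j = c j :=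
    congrFun ((degreeLTEquiv F n).apply_symm_apply c) j
  have p_add (n : ℕ) (c d : Fin n → F) : p n (c + d) = p n c + p n d := by simp [p]
  let enc (m : Fin (Nat.card ι - μ) → F) (r : Fin μ → F) (i : ι) : F :=
    (p μ r + X ^ μ * p _ m).eval (x i)
  obtain ⟨dec, hdec⟩ := exists_dec enc fun m r m' r' h => by
    -- Here the truncated `N - μ` is zero, so there is only one message; otherwise the degree stays
    -- below `N`.
    by_cases hμ : Nat.card ι ≤ μ
    · have : IsEmpty (Fin (Nat.card ι - μ)) := by
        rw [Nat.sub_eq_zero_of_le hμ]; infer_instance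
      exact Subsingleton.elim _ _
    have deg (m : Fin (Nat.card ι - μ) → F) (r : Fin μ → F) :
        (p μ r + X ^ μ * p _ m).degree < ((Finset.univ : Finset ι).card : WithBot ℕ) := by
      rw [Finset.card_univ, ← Nat.card_eq_fintype_card]
      refine (degree_add_le _ _).trans_lt (max_lt ((p_deg μ r).trans ?_) ?_)
      · exact_mod_cast not_le.1 hμ
      · rw [← mem_degreeLT, mem_degreeLT, degree_lt_iff_coeff_zero]
        intro k hk
        rw [coeff_X_pow_mul', if_pos (by omega)]
        exact (degree_lt_iff_coeff_zero _ _).1 (p_deg _ m) _ (by omega)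
    have heq := Polynomial.eq_of_degrees_lt_of_eval_index_eq Finset.univ x.injective.injOn
      (deg m r) (deg m' r') fun i _ => congrFun h i
    funext j
    have hj := congrArg (fun P => coeff P (j + μ)) heq
    simp only [coeff_add, coeff_X_pow_mul, p_coeff] at hj
    rwa [(degree_lt_iff_coeff_zero _ _).1 (p_deg μ r) _ (by omega),
      (degree_lt_iff_coeff_zero _ _).1 (p_deg μ r') _ (by omega), zero_add, zero_add] at hj
  refine ⟨⟨Fin μ → F, enc, dec, hdec, fun A hA => .of_perm fun m m' => ?_⟩⟩
  -- Interpolating the difference of the message parts on `A` has degree below `|A| ≤ μ`, hence is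
  -- an admissible key shift.
  let P := Lagrange.interpolate A x fun i => (X ^ μ * p _ m).eval (x i) - (X ^ μ * p _ m').eval (x i)
  have hP : P ∈ degreeLT F μ := mem_degreeLT.2 <|
    (Lagrange.degree_interpolate_lt _ x.injective.injOn).trans_le (by exact_mod_cast hA)
  have hp : p μ (degreeLTEquiv F μ ⟨P, hP⟩) = P := by simp [p]
  refine ⟨Equiv.addRight (degreeLTEquiv F μ ⟨P, hP⟩), fun r => funext fun i => ?_⟩
  have hi := Lagrange.eval_interpolate_at_node
    (fun i => (X ^ μ * p _ m).eval (x i) - (X ^ μ * p _ m').eval (x i)) x.injective.injOn i.2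
  simp only [enc, Equiv.coe_addRight, p_add, hp, eval_add]
  rw [hi]
  ring

end Wiretap

/-! ### Counting pairs of nodes -/

/-- The handshake lemma for the graph whose edges are the pairs satisfying `P`. -/
theorem two_mul_card_pair {V : Type*} [Fintype V] (P : {e : Sym2 V // ¬ e.IsDiag} → Prop) :
    2 * Nat.card {e // P e} =
      ∑ x : V, Nat.card {y // ∃ h : x ≠ y, P ⟨s(x, y), by simpa using h⟩} := by
  classical
  let G : SimpleGraph V := SimpleGraph.fromEdgeSet {e | ∃ h : ¬ e.IsDiag, P ⟨e, h⟩}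
  have hE : Nat.card {e // P e} = G.edgeFinset.card := by
    rw [SimpleGraph.edgeFinset_card, ← Nat.card_eq_fintype_card]
    refine Nat.card_congr ((Equiv.subtypeSubtypeEquivSubtypeExists _ _).trans
      (Equiv.subtypeEquivRight fun e => ?_))
    simp only [G, SimpleGraph.edgeSet_fromEdgeSet, Set.mem_sdiff, Set.mem_ofPred_eq]
    exact ⟨fun h => ⟨h, h.1⟩, fun h => h.1⟩
  have hG := G.sum_degrees_eq_twice_card_edges
  rw [hE]
  refine Eq.trans (by convert hG.symm) (Finset.sum_congr rfl fun x _ => ?_)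
  rw [← SimpleGraph.card_neighborSet_eq_degree, ← Nat.card_eq_fintype_card]
  refine Nat.card_congr (Equiv.subtypeEquivRight fun y => ?_)
  simp only [G, SimpleGraph.mem_neighborSet, SimpleGraph.fromEdgeSet_adj, Set.mem_ofPred_eq]
  exact ⟨fun h => ⟨h.2, h.1.2⟩, fun ⟨hne, hP⟩ => ⟨⟨_, hP⟩, hne⟩⟩

namespace RSKR

variable {L nI : ℕ}

/-- A pair across two clusters, at least one of which is in `E`. -/
def Touches (E : Finset (Fin L)) (e : Pair L nI) : Prop := ∃ x ∈ e.1, x.1 ∈ E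

theorem intra_mk {x y : Node L nI} (h : ¬ (s(x, y)).IsDiag) :
    Intra (⟨s(x, y), h⟩ : Pair L nI) ↔ x.1 = y.1 := by
  simp only [Intra, Sym2.mem_iff, forall_eq_or_imp, forall_eq, true_and, and_true]
  exact ⟨fun h => h.1, fun h => ⟨h, h.symm⟩⟩

theorem touches_mk {E : Finset (Fin L)} {x y : Node L nI} (h : ¬ (s(x, y)).IsDiag) :
    Touches E (⟨s(x, y), h⟩ : Pair L nI) ↔ x.1 ∈ E ∨ y.1 ∈ E := by
  simp [Touches]

theorem card_cluster_mem (S : Finset (Fin L)) :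
    Nat.card {y : Node L nI // y.1 ∈ S} = S.card * nI := by
  rw [Nat.card_congr (Equiv.prodSubtypeFstEquivSubtypeProd (p := fun c => c ∈ S))]
  simp

theorem card_intra_neighbor (x : Node L nI) :
    Nat.card {y : Node L nI // x ≠ y ∧ x.1 = y.1} = nI - 1 := by
  have : Nat.card {j : Fin nI // j ≠ x.2} = nI - 1 := by simp
  rw [← this]
  exact Nat.card_congr
    { toFun := fun y => ⟨y.1.2, fun h => y.2.1 (Prod.ext y.2.2 h.symm)⟩
      invFun := fun j => ⟨(x.1, j.1), fun h => j.2 (congrArg Prod.snd h).symm, rfl⟩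
      left_inv := fun y => Subtype.ext (Prod.ext y.2.2 rfl)
      right_inv := fun j => rfl }

theorem two_mul_card_intraPair : 2 * Nat.card (IntraPair L nI) = L * nI * (nI - 1) := by
  rw [two_mul_card_pair]
  simp only [intra_mk, exists_prop, card_intra_neighbor]
  simp

/-- From inside `E` every node of another cluster counts; from outside, only the nodes of `E`. -/
theorem card_touching_neighbor (E : Finset (Fin L)) (x : Node L nI) :
    Nat.card {y : Node L nI // x ≠ y ∧ x.1 ≠ y.1 ∧ (x.1 ∈ E ∨ y.1 ∈ E)} =
      if x.1 ∈ E then (L - 1) * nI else E.card * nI := by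
  split_ifs with hx
  · have : ({x.1}ᶜ : Finset (Fin L)).card = L - 1 := by simp [Finset.card_compl]
    rw [← this, ← card_cluster_mem]
    refine Nat.card_congr (Equiv.subtypeEquivRight fun y => ?_)
    simp only [hx, true_or, and_true, Finset.mem_compl, Finset.mem_singleton]
    exact ⟨fun h => fun e => h.2 e.symm, fun h => ⟨fun e => h (by rw [e]), fun e => h e.symm⟩⟩
  · rw [← card_cluster_mem]
    refine Nat.card_congr (Equiv.subtypeEquivRight fun y => ?_)
    simp only [hx, false_or]
    exact ⟨fun h => h.2.2, fun h => ⟨fun e => hx (by rwa [e]), fun e => hx (by rwa [e]), h⟩⟩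

theorem two_mul_card_touching (E : Finset (Fin L)) :
    2 * Nat.card {e : Pair L nI // ¬ Intra e ∧ Touches E e} =
      E.card * nI * ((L - 1) * nI) + (L - E.card) * nI * (E.card * nI) := by
  rw [two_mul_card_pair]
  simp only [intra_mk, touches_mk, exists_prop, card_touching_neighbor]
  have hc (S : Finset (Fin L)) :
      (Finset.univ.filter fun x : Node L nI => x.1 ∈ S).card = S.card * nI := by
    rw [← card_cluster_mem, Nat.card_eq_fintype_card, Fintype.card_subtype]
  have hc' : (Finset.univ.filter fun x : Node L nI => x.1 ∉ E).card = (L - E.card) * nI := by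
    simpa [Finset.card_compl] using hc Eᶜ
  rw [Finset.sum_ite, Finset.sum_const, Finset.sum_const, hc, hc', smul_eq_mul, smul_eq_mul]

theorem two_mul_card_crossPair :
    2 * Nat.card (CrossPair L nI) = L * nI * ((L - 1) * nI) := by
  have h := two_mul_card_touching (L := L) (nI := nI) Finset.univ
  rw [Finset.card_fin, Nat.sub_self, zero_mul, zero_mul, add_zero] at h
  rw [← h]
  congr 1
  refine Nat.card_congr (Equiv.subtypeEquivRight fun e => ?_)
  refine ⟨fun h => ⟨h, ?_⟩, fun h => h.1⟩
  exact ⟨_, e.1.out_fst_mem, Finset.mem_univ _⟩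

theorem two_mul_exposed {Lc : ℕ} (hLc : Lc ≤ L) :
    2 * exposed L nI Lc = Lc * nI * ((L - 1) * nI) + (L - Lc) * nI * (Lc * nI) := by
  induction Lc with
  | zero => simp [exposed]
  | succ c ih =>
    have h := ih (by omega)
    rw [exposed] at h ⊢
    rw [Finset.sum_Icc_succ_top (by omega), mul_add, h]
    obtain ⟨d, rfl⟩ := Nat.exists_eq_add_of_le hLc
    have h1 : (c + 1 + d) * nI - (c + 1) * nI = d * nI := by rw [← Nat.sub_mul]; congr 1; omega
    rw [h1, show c + 1 + d - c = d + 1 by omega, show c + 1 + d - 1 = c + d by omega,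
      show c + 1 + d - (c + 1) = d by omega]
    ring

theorem card_touching {Lc : ℕ} (E : Finset (Fin L)) (hE : E.card = Lc) :
    Nat.card {e : Pair L nI // ¬ Intra e ∧ Touches E e} = exposed L nI Lc := by
  have h := two_mul_card_touching (nI := nI) E
  have h' := two_mul_exposed (nI := nI) (hE ▸ (Finset.card_le_univ E).trans_eq (by simp) : Lc ≤ L)
  rw [hE, ← h'] at h
  omega

/-- Ensures that the subtraction in the message length is not truncated. -/
theorem exposed_le_card_crossPair {Lc : ℕ} (hLc : Lc ≤ L) :
    exposed L nI Lc ≤ Nat.card (CrossPair L nI) := by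
  obtain ⟨E, -, hE⟩ := Finset.exists_subset_card_eq
    (s := (Finset.univ : Finset (Fin L))) (n := Lc) (by simpa)
  rw [← card_touching E hE]
  exact Nat.card_le_card_of_injective (fun e => (⟨e.1, e.2.1⟩ : CrossPair L nI))
    fun a b h => Subtype.ext (congrArg (fun e : CrossPair L nI => e.1) h)

theorem card_message_symbols {Lc : ℕ} (hL : 0 < L) (hnI : 0 < nI) (hLc : Lc ≤ L) :
    Nat.card (IntraPair L nI) + (Nat.card (CrossPair L nI) - exposed L nI Lc) =
      Lc * nI.choose 2 + (L * nI - nI * Lc).choose 2 := by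
  have h1 := two_mul_card_intraPair (L := L) (nI := nI)
  have h2 := two_mul_card_crossPair (L := L) (nI := nI)
  have h3 := two_mul_exposed (nI := nI) hLc
  have h4 := exposed_le_card_crossPair (nI := nI) hLc
  have h5 : nI * Lc ≤ L * nI := by rw [mul_comm]; exact Nat.mul_le_mul_right _ hLc
  -- Over `ℚ` the subtractions are genuine and the doubled counts combine linearly.
  have h1' := congrArg (Nat.cast (R := ℚ)) h1
  have h2' := congrArg (Nat.cast (R := ℚ)) h2
  have h3' := congrArg (Nat.cast (R := ℚ)) h3
  push_cast [Nat.cast_sub hnI, Nat.cast_sub hL, Nat.cast_sub hLc] at h1' h2' h3'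
  rw [← Nat.cast_inj (R := ℚ)]
  push_cast [Nat.cast_sub h4, Nat.cast_choose_two, Nat.cast_sub h5]
  linear_combination h1' / 2 + h2' / 2 - h3' / 2

/-! ### Structure of the repetition code -/

variable {β : ℕ}

theorem ncard_storing (s : Sym L nI β) : {x : Node L nI | s ∈ storedOn x}.ncard = 2 := by
  obtain ⟨⟨e, he⟩, b⟩ := s
  induction e using Sym2.ind with
  | _ x y =>
    rw [show {z : Node L nI | ((⟨s(x, y), he⟩, b) : Sym L nI β) ∈ storedOn z} = {x, y} by
      ext z; simp [storedOn]]
    exact Set.ncard_pair (by simpa using he)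

theorem existsUnique_shared {x y : Node L nI} (b : Fin β) (hxy : x ≠ y) :
    ∃! s : Sym L nI β, s.2 = b ∧ s ∈ storedOn x ∧ s ∈ storedOn y := by
  refine ⟨(⟨s(x, y), by simpa using hxy⟩, b), ⟨rfl, Sym2.mem_mk_left x y, Sym2.mem_mk_right x y⟩,
    ?_⟩
  rintro ⟨⟨e, he⟩, b'⟩ ⟨rfl, hx, hy⟩
  exact Prod.ext (Subtype.ext ((Sym2.mem_and_mem_iff hxy).1 ⟨hx, hy⟩)) rfl

theorem card_slot (x : Node L nI) : Nat.card (Slot L nI β x) = (L * nI - 1) * β := by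
  have h : Nat.card ({y : Node L nI // y ≠ x} × Fin β) = (L * nI - 1) * β := by simp
  rw [← h]
  refine (Nat.card_congr (Equiv.ofBijective (fun p : {y : Node L nI // y ≠ x} × Fin β =>
    (⟨(⟨s(x, p.1.1), by simpa using p.1.2.symm⟩, p.2), Sym2.mem_mk_left x p.1.1⟩ :
      Slot L nI β x)) ⟨?_, ?_⟩)).symm
  · rintro ⟨⟨y, hy⟩, b⟩ ⟨⟨z, hz⟩, c⟩ h
    have h' := congrArg (fun s : Slot L nI β x => (s.1.1.1, s.1.2)) h
    simp only [Prod.mk.injEq, Sym2.congr_right] at h'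
    simpa using h'
  · rintro ⟨⟨⟨e, he⟩, b⟩, hx⟩
    exact ⟨(⟨Sym2.Mem.other hx, Sym2.other_ne he hx⟩, b),
      Subtype.ext (Prod.ext (Subtype.ext (Sym2.other_spec hx)) rfl)⟩

/-! ### Repair, reconstruction and secrecy -/

variable {F : Type u} {Lc : ℕ}

theorem step_encode (W : CrossCode F L nI Lc) (m : Msg F L nI Lc β) (r : Fin β → W.Key)
    (y : Node L nI) :
    (scheme β W).step ((scheme β W).encode m r) y = (scheme β W).encode m r := by
  classical
  rw [StorageScheme.step]
  convert Function.update_eq_self y _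
  funext s
  simp only [scheme]
  congr 3
  -- The helper names the pair with itself first, `Sym2.other_spec` with the newcomer first.
  rw [Sym2.eq_swap]
  exact Sym2.other_spec s.2

theorem run_encode (W : CrossCode F L nI Lc) (m : Msg F L nI Lc β) (r : Fin β → W.Key)
    (h : List (Node L nI)) :
    (scheme β W).run ((scheme β W).encode m r) h = (scheme β W).encode m r := by
  induction h with
  | nil => rfl
  | cons y h ih => rw [StorageScheme.run, List.foldl_cons, step_encode]; exact ih

open Classical in
theorem view_encode (W : CrossCode F L nI Lc) (m : Msg F L nI Lc β) (r : Fin β → W.Key)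
    (E : Finset (Fin L)) (h : List (Node L nI)) :
    (scheme β W).view Prod.fst E ((scheme β W).encode m r) h =
      h.map fun y x => if hx : x.1 ≠ y.1 ∧ (x.1 ∈ E ∨ y.1 ∈ E) then
        some fun b => codeword W m r
          (⟨s(x, y), by simpa using fun e : x = y => hx.1 (congrArg Prod.fst e)⟩, b)
        else none := by
  induction h with
  | nil => rfl
  | cons y h ih =>
    rw [StorageScheme.view, step_encode, ih, List.map_cons]
    congr 1
    funext x
    split_ifs <;> rfl

theorem codeword_injective (W : CrossCode F L nI Lc) {m m' : Msg F L nI Lc β}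
    {r r' : Fin β → W.Key} (h : codeword W m r = codeword W m' r') : m = m' := by
  refine Prod.ext (funext₂ fun e b => ?_) (funext fun b => ?_)
  · have := congrFun h (e.1, b)
    simpa only [codeword, dif_pos e.2] using this
  · rw [← W.dec_enc (m.2 b) (r b), ← W.dec_enc (m'.2 b) (r' b)]
    congr 1
    funext e
    have := congrFun h (e.1, b)
    simpa only [codeword, dif_neg e.2] using this

theorem exists_mem_of_card {K : Finset (Node L nI)} (hK : K.card = L * nI - 1) (e : Pair L nI) :
    ∃ x ∈ e.1, x ∈ K := by
  classical
  obtain ⟨e, he⟩ := e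
  induction e using Sym2.ind with
  | _ x y =>
    by_contra! h
    have hx := h x (Sym2.mem_mk_left x y)
    have hy := h y (Sym2.mem_mk_right x y)
    have h2 : ({x, y} : Finset (Node L nI)) ⊆ Kᶜ := by
      simp [Finset.insert_subset_iff, hx, hy]
    have h3 := Finset.card_le_card h2
    rw [Finset.card_pair (by simpa using he), Finset.card_compl, hK] at h3
    simp only [Fintype.card_prod, Fintype.card_fin] at h3
    omega

theorem reconstruct [Nonempty F] (W : CrossCode F L nI Lc) (h : List (Node L nI))
    {K : Finset (Node L nI)} (hK : K.card = L * nI - 1) :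
    ∃ dec : ((x : K) → Slot L nI β x.1 → F) → Msg F L nI Lc β, ∀ m r,
      dec (fun x => (scheme β W).run ((scheme β W).encode m r) h x.1) = m := by
  refine exists_dec _ fun m r m' r' hm => codeword_injective W (r := r) (r' := r') ?_
  funext s
  obtain ⟨x, hx, hxK⟩ := exists_mem_of_card hK s.1
  simp only [run_encode] at hm
  exact congrFun (congrFun hm ⟨x, hxK⟩) ⟨s, hx⟩

theorem secret (W : CrossCode F L nI Lc) (h : List (Node L nI)) {E : Finset (Fin L)}
    (hE : E.card = Lc) :
    PerfectlySecret fun (m : Msg F L nI Lc β) r =>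
      (scheme β W).view Prod.fst E ((scheme β W).encode m r) h := by
  classical
  let A : Finset (CrossPair L nI) := Finset.univ.filter fun e => Touches E e.1
  have hA : A.card ≤ exposed L nI Lc := by
    rw [← card_touching E hE, ← Nat.card_congr (Equiv.subtypeSubtypeEquivSubtypeInter _ _),
      Nat.card_eq_fintype_card, Fintype.card_subtype]
  have hx_mem {x y : Node L nI} (hx : x.1 ≠ y.1 ∧ (x.1 ∈ E ∨ y.1 ∈ E)) :
      ∃ (h : ¬ (s(x, y)).IsDiag) (h' : ¬ Intra (⟨s(x, y), h⟩ : Pair L nI)),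
        (⟨⟨s(x, y), h⟩, h'⟩ : CrossPair L nI) ∈ A :=
    ⟨by simpa using fun e : x = y => hx.1 (congrArg Prod.fst e), by rw [intra_mk]; exact hx.1,
      Finset.mem_filter.2 ⟨Finset.mem_univ _, (touches_mk _).2 hx.2⟩⟩
  -- Rebuilds the view from the symbols in `A` alone, so secrecy follows by postprocessing.
  let g (o : Fin β → A → F) : List (Node L nI → Option (Fin β → F)) :=
    h.map fun y x => if hx : x.1 ≠ y.1 ∧ (x.1 ∈ E ∨ y.1 ∈ E) then
      some fun b => o b ⟨_, (hx_mem hx).2.2⟩ else none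
  have hg (m : Msg F L nI Lc β) (r : Fin β → W.Key) :
      (scheme β W).view Prod.fst E ((scheme β W).encode m r) h =
        g fun b i => W.enc (m.2 b) (r b) i := by
    rw [view_encode]
    refine List.map_congr_left fun y _ => funext fun x => ?_
    split_ifs with hx
    · exact congrArg some (funext fun b => dif_neg (hx_mem hx).2.1)
    · rfl
  simp only [hg]
  exact fun m m' => (W.secret A hA).pi.postcomp g m.2 m'.2

theorem securelyStores [Field F] [Fintype F] (W : CrossCode F L nI Lc) {α : ℝ} (hL : 0 < L)
    (hnI : 0 < nI) (hLc : Lc ≤ L) (hα : ((L : ℝ) * nI - 1) * β ≤ α) :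
    (scheme β W).SecurelyStores Prod.fst (L * nI - 1) Lc α
      ((Lc * nI.choose 2 + (L * nI - nI * Lc).choose 2) * β) where
  finite_slot x := inferInstance
  storage x := by
    rw [card_slot]
    have : 1 ≤ L * nI := Nat.mul_pos hL hnI
    push_cast [Nat.cast_sub this]
    exact hα
  amount := by
    rw [← card_message_symbols hL hnI hLc, Msg, Nat.card_prod]
    simp only [Nat.card_fun, Nat.card_fin, ← pow_mul, ← pow_add]
    congr 1
    ring
  reconstruct h K hK := reconstruct W h hK
  secret h E hE := secret W h hE

end RSKR

/-! ### The bound in the bandwidth-limited regime -/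

theorem sum_Icc_sub (m n : ℕ) (h : m < n) :
    ∑ i ∈ Finset.Icc (m + 1) (n - 1), ((n : ℝ) - i) = ((n - m).choose 2 : ℕ) := by
  obtain ⟨d, rfl⟩ := Nat.exists_eq_add_of_lt h
  induction d generalizing m with
  | zero => simp
  | succ d ih =>
    have := ih (m + 1) (by omega)
    rw [show m + (d + 1) + 1 - 1 = m + d + 1 by omega, ← Finset.add_sum_Ioc_eq_sum_Icc (by omega),
      ← Finset.Icc_add_one_left_eq_Ioc]
    rw [show m + 1 + d + 1 - 1 = m + d + 1 by omega, show m + 1 + d + 1 = m + (d + 1) + 1 by ring]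
      at this
    rw [this, Nat.cast_choose_two, Nat.cast_choose_two,
      show m + (d + 1) + 1 - (m + 1) = d + 1 by omega, show m + (d + 1) + 1 - m = d + 2 by omega]
    push_cast
    ring

/-- `N` is the total number of nodes, so one hypothesis on `α` serves both `n = nI` and `n = N`. -/
theorem sum_min_eq {n N : ℕ} {α β : ℝ} (hβ : 0 ≤ β) {s : Finset ℕ}
    (hs : ∀ i ∈ s, 1 ≤ i) (hn : n ≤ N) (hα : ((N : ℝ) - 1) * β ≤ α) :
    ∑ i ∈ s, min (((n : ℝ) - i) * β) α = (∑ i ∈ s, ((n : ℝ) - i)) * β := by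
  rw [Finset.sum_mul]
  refine Finset.sum_congr rfl fun i hi => min_eq_left (le_trans ?_ hα)
  have h1 : (1 : ℝ) ≤ i := by exact_mod_cast hs i hi
  have h2 : (n : ℝ) ≤ N := by exact_mod_cast hn
  exact mul_le_mul_of_nonneg_right (by linarith) hβ

theorem nodeRestrictedBound_eq {L nI Lc β : ℕ} {α : ℝ} (hL : 0 < L) (hnI : 0 < nI)
    (hLc : Lc ≤ L) (hα : ((L : ℝ) * nI - 1) * β ≤ α) :
    nodeRestrictedBound (L * nI) (L * nI - 1) nI Lc α β =
      (((Lc * nI.choose 2 + (L * nI - nI * Lc).choose 2) * β : ℕ) : ℝ) := by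
  have hβ : (0 : ℝ) ≤ β := β.cast_nonneg
  have hα' : (((L * nI : ℕ) : ℝ) - 1) * β ≤ α := by push_cast; exact hα
  have hn : nI ≤ L * nI := Nat.le_mul_of_pos_left _ hL
  have hs (a b i : ℕ) : i ∈ Finset.Icc (a + 1) b → 1 ≤ i := fun hi => by
    have := (Finset.mem_Icc.1 hi).1; omega
  have hsum : ∑ i ∈ Finset.Icc 1 (nI - 1), ((nI : ℝ) - i) = (nI.choose 2 : ℕ) := by
    simpa using sum_Icc_sub 0 nI hnI
  -- The term `i = nI` vanishes, so a cluster short of one node contributes as much as a full one.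
  have hsum' : ∑ i ∈ Finset.Icc 1 nI, ((nI : ℝ) - i) = (nI.choose 2 : ℕ) := by
    obtain ⟨c, rfl⟩ := Nat.exists_eq_add_of_lt hnI
    rw [zero_add] at hsum ⊢
    rw [Finset.sum_Icc_succ_top (by omega), ← hsum]
    simp
  rw [nodeRestrictedBound]
  split_ifs with h
  · rw [sum_min_eq (N := L * nI) hβ (hs 0 nI) hn hα', sum_min_eq (N := L * nI) hβ (hs _ _) le_rfl hα', hsum',
      sum_Icc_sub _ _ (by omega)]
    push_cast
    ring
  -- Here `k = (L - 1) * nI + (nI - 1)`, so the bound is `L` times the cluster sum. The case needs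
  -- `Lc = L`, or `nI = 1` with `Lc = L - 1`, where both sides are zero.
  · obtain ⟨l, rfl⟩ := Nat.exists_eq_add_of_lt hL
    obtain ⟨c, rfl⟩ := Nat.exists_eq_add_of_lt hnI
    simp only [zero_add] at *
    have hk : (l + 1) * (c + 1) - 1 = c + (c + 1) * l := by
      rw [show (l + 1) * (c + 1) = c + (c + 1) * l + 1 by ring]; omega
    have hdiv : ((l + 1) * (c + 1) - 1) / (c + 1) = l := by
      rw [hk, Nat.add_mul_div_left _ _ (by omega), Nat.div_eq_of_lt (by omega), zero_add]
    have hmod : ((l + 1) * (c + 1) - 1) % (c + 1) = c := by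
      rw [hk, Nat.add_mul_mod_self_left, Nat.mod_eq_of_lt (by omega)]
    rw [hdiv, hmod, sum_min_eq (N := (l + 1) * (c + 1)) hβ (hs 0 _) hn hα', sum_min_eq (N := (l + 1) * (c + 1)) hβ (hs 0 _) hn hα', hsum']
    rw [Nat.add_sub_cancel] at hsum
    rw [hsum]
    rcases hLc.eq_or_lt with rfl | hlt
    · rw [mul_comm (c + 1) (l + 1), Nat.sub_self]
      push_cast
      simp
      ring
    · have hc : c = 0 := by
        have : (c + 1) * Lc ≤ (c + 1) * l := Nat.mul_le_mul_left _ (by omega)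
        omega
      subst hc
      have hLl : Lc = l := by omega
      subst hLl
      simp

theorem mainTheorem2 {F : Type*} [Field F] [Fintype F] (L nI Lc β : ℕ) (α : ℝ)
    (hL : 0 < L) (hnI : 0 < nI) (hLc : Lc ≤ L)
    (hα : ((L : ℝ) * nI - 1) * β ≤ α)
    (hF : Nat.card (RSKR.CrossPair L nI) ≤ Nat.card F) :
    -- each coded symbol is stored on exactly two nodes
    (∀ s : RSKR.Sym L nI β, {x : RSKR.Node L nI | s ∈ RSKR.storedOn x}.ncard = 2) ∧
    -- in each layer, any two nodes share exactly one coded symbol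
    (∀ (x y : RSKR.Node L nI) (b : Fin β), x ≠ y →
      ∃! s : RSKR.Sym L nI β, s.2 = b ∧ s ∈ RSKR.storedOn x ∧ s ∈ RSKR.storedOn y) ∧
    -- the required wiretap codes exist
    Nonempty (RSKR.CrossCode F L nI Lc) ∧
    ∀ W : RSKR.CrossCode F L nI Lc,
      -- intra-cluster symbols are stored uncoded
      (∀ (m : RSKR.Msg F L nI Lc β) (r : Fin β → W.Key) (x : RSKR.Node L nI)
        (s : RSKR.Slot L nI β x) (h : RSKR.Intra s.1.1),
        (RSKR.scheme β W).encode m r x s = m.1 ⟨s.1.1, h⟩ s.1.2) ∧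
      -- cross-cluster symbols are protected by the wiretap code
      (∀ (m : RSKR.Msg F L nI Lc β) (r : Fin β → W.Key) (x : RSKR.Node L nI)
        (s : RSKR.Slot L nI β x) (h : ¬ RSKR.Intra s.1.1),
        (RSKR.scheme β W).encode m r x s = W.enc (m.2 s.1.2) (r s.1.2) ⟨s.1.1, h⟩) ∧
      -- the secure amount, and its agreement with the upper bound
      (RSKR.scheme β W).SecurelyStores Prod.fst (L * nI - 1) Lc α
        ((Lc * nI.choose 2 + (L * nI - nI * Lc).choose 2) * β) ∧
      (((Lc * nI.choose 2 + (L * nI - nI * Lc).choose 2) * β : ℕ) : ℝ) =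
        nodeRestrictedBound (L * nI) (L * nI - 1) nI Lc α β := by
  exact ⟨RSKR.ncard_storing, fun _ _ b hxy => RSKR.existsUnique_shared b hxy,
    exists_wiretapIICode _ hF, fun W =>
    ⟨fun _ _ _ _ h => dif_pos h, fun _ _ _ _ h => dif_neg h,
      RSKR.securelyStores W hL hnI hLc hα, (nodeRestrictedBound_eq hL hnI hLc hα).symm⟩⟩
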